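/- For a function $f:\mathbb{R}\to\mathbb{R}$ let $G(f)=\{(x,f(x)) : x\in\mathbb{R}\}\subseteq\mathbb{R}^2$ denote its graph, with the subspace topology. Call $f$ additive if $f(x+y)=f(x)+f(y)$ for all $x,y\in\mathbb{R}$. If $f$ is additive, then $G(f)$ is either connected or totally disconnected (i.e. every connected subset of $G(f)$ has at most one point). Furthermore, there exists a discontinuous additive function $f:\mathbb{R}\to\mathbb{R}$ whose graph is connected, and there exists a discontinuous additive function $f:\mathbb{R}\to\mathbb{R}$ whose graph is totally disconnected. -/

import Mathlib

open Set Cardinal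

/-! The graph is a topological group and its projection to ℝ is injective. If its identity component
is nontrivial, that component projects onto a subgroup containing an interval, hence onto ℝ, and so
is the whole graph. For the connected example, at most 𝔠 closed plane sets have a projection with
interior. Transfinite recursion picks a point in each, with ℚ-independent abscissae: a subspace of
ℚ-dimension below 𝔠 contains no interval. A ℚ-linear map through these points meets every such set.
For the other example, a nonzero ℚ-valued functional has countable range, so its graph is not
connected. -/

/-- A well-ordered family of vectors, each outside the span of its predecessors, is linearly
independent. -/
theorem linearIndependent_of_notMem_span_image_Iio {ι K V : Type*} [LinearOrder ι]
    [DivisionRing K] [AddCommGroup V] [Module K V] {v : ι → V}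
    (h : ∀ i, v i ∉ Submodule.span K (v '' Iio i)) : LinearIndependent K v := by
  classical
  rw [linearIndependent_iff]
  intro l hl
  by_contra hne
  have hsupp : l.support.Nonempty := Finsupp.support_nonempty_iff.2 hne
  set m := l.support.max' hsupp
  have hm : m ∈ l.support := Finset.max'_mem _ _
  refine h m ?_
  rw [Finsupp.linearCombination_apply, Finsupp.sum, ← Finset.add_sum_erase _ _ hm] at hl
  rw [← Submodule.smul_mem_iff _ (Finsupp.mem_support_iff.1 hm), eq_neg_of_add_eq_zero_left hl]
  refine Submodule.neg_mem _ (Submodule.sum_mem _ fun i hi ↦ Submodule.smul_mem _ _ ?_)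
  exact Submodule.subset_span (mem_image_of_mem _ (Finset.lt_max'_of_mem_erase_max' _ hsupp hi))

/-- Linearly independent transversal of a family of sets, none of which is contained in a
subspace of dimension smaller than the size of the family. -/
theorem exists_linearIndependent_forall_mem.{u} {ι K V : Type u} [DivisionRing K] [AddCommGroup V]
    [Module K V] (P : ι → Set V)
    (hP : ∀ i, ∀ W : Submodule K V, Module.rank K W < #ι → ∃ v ∈ P i, v ∉ W) :
    ∃ v : ι → V, LinearIndependent K v ∧ ∀ i, v i ∈ P i := by
  -- In a well-order of minimal type each index has fewer than `#ι` predecessors, so `hP` applies to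
  -- the span of their values.
  obtain ⟨_, _, hι⟩ := exists_ord_eq_type_lt ι
  have hex : ∀ i (u : Iio i → V), ∃ v ∈ P i, v ∉ Submodule.span K (range u) := fun i u ↦
    hP i _ ((rank_span_le _).trans_lt (mk_range_le.trans_lt (mk_Iio_lt i hι)))
  choose next hnextP hnext using hex
  let v : ι → V := wellFounded_lt.fix fun i u ↦ next i fun j ↦ u j.1 j.2
  have hv : ∀ i, v i = next i fun j : Iio i ↦ v j := fun i ↦ wellFounded_lt.fix_eq _ i
  refine ⟨v, linearIndependent_of_notMem_span_image_Iio fun i ↦ ?_, fun i ↦ ?_⟩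
  · have := hnext i fun j : Iio i ↦ v j
    rwa [← hv, ← image_eq_range] at this
  · rw [hv]
    exact hnextP _ _

/-- Prescribing the values of a linear map on a linearly independent family. -/
theorem LinearIndependent.exists_linearMap_apply_eq {ι K V V' : Type*} [DivisionRing K]
    [AddCommGroup V] [Module K V] [AddCommGroup V'] [Module K V'] {v : ι → V}
    (hv : LinearIndependent K v) (y : ι → V') : ∃ f : V →ₗ[K] V', ∀ i, f (v i) = y i := by
  obtain ⟨g, hg⟩ := LinearMap.exists_extend ((Module.Basis.span hv).constr ℕ y)
  refine ⟨g, fun i ↦ ?_⟩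
  have := LinearMap.congr_fun hg (Module.Basis.span hv i)
  rwa [Module.Basis.constr_basis, LinearMap.comp_apply, Submodule.subtype_apply,
    Module.Basis.span_apply] at this

theorem AddSubgroup.eq_top_of_interior_nonempty {G : Type*} [AddGroup G] [TopologicalSpace G]
    [IsTopologicalAddGroup G] [PreconnectedSpace G] (H : AddSubgroup G)
    (h : (interior (H : Set G)).Nonempty) : H = ⊤ := by
  obtain ⟨x, hx⟩ := h
  have hopen := H.isOpen_of_mem_nhds (mem_interior_iff_mem_nhds.1 hx)
  exact SetLike.coe_injective
    (IsClopen.eq_univ ⟨H.isClosed_of_isOpen hopen, hopen⟩ ⟨0, H.zero_mem⟩)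

theorem mk_isClosed_le_continuum (X : Type*) [TopologicalSpace X] [SecondCountableTopology X] :
    #{F : Set X // IsClosed F} ≤ 𝔠 := by
  borelize X
  refine le_trans (mk_subtype_mono (q := MeasurableSet) fun F hF ↦ hF.measurableSet) ?_
  obtain ⟨b, hb, hbX⟩ := MeasurableSpace.CountablyGenerated.isCountablyGenerated (α := X)
  rw [hbX]
  exact MeasurableSpace.cardinal_measurableSet_le_continuum
    ((le_aleph0_iff_set_countable.2 hb).trans aleph0_le_continuum)

/-- There is an additive function whose graph meets every closed subset of the plane whose
projection to the first axis has an interior point. -/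
theorem exists_linearMap_graph_meets_closed :
    ∃ f : ℝ →ₗ[ℚ] ℝ, ∀ F : Set (ℝ × ℝ), IsClosed F → (interior (Prod.fst '' F)).Nonempty →
      ∃ x, (x, f x) ∈ F := by
  let ι := {F : Set (ℝ × ℝ) // IsClosed F ∧ (interior (Prod.fst '' F)).Nonempty}
  have hι : #ι ≤ 𝔠 :=
    (mk_subtype_mono fun F hF ↦ hF.1).trans (mk_isClosed_le_continuum (ℝ × ℝ))
  obtain ⟨v, hv, hvP⟩ := exists_linearIndependent_forall_mem (K := ℚ)
      (fun F : ι ↦ Prod.fst '' F.1) fun F W hW ↦ by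
    by_contra! hcon
    have htop := AddSubgroup.eq_top_of_interior_nonempty W.toAddSubgroup
      (F.2.2.mono (interior_mono hcon))
    have hW' : W = ⊤ := by
      rw [eq_top_iff]
      intro x _
      have : x ∈ W.toAddSubgroup := htop ▸ AddSubgroup.mem_top x
      exact this
    rw [hW', rank_top, Real.rank_rat_real] at hW
    exact hW.not_ge hι
  choose p hpF hpv using hvP
  obtain ⟨f, hf⟩ := hv.exists_linearMap_apply_eq fun F ↦ (p F).2
  refine ⟨f, fun F hF hFi ↦ ⟨v ⟨F, hF, hFi⟩, ?_⟩⟩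
  rw [hf, ← hpv]
  exact hpF ⟨F, hF, hFi⟩

/-- A function whose graph meets every closed set with a fat projection has connected graph. -/
theorem isConnected_graphOn_of_meets_closed {f : ℝ → ℝ}
    (hf : ∀ F : Set (ℝ × ℝ), IsClosed F → (interior (Prod.fst '' F)).Nonempty →
      ∃ x, (x, f x) ∈ F) : IsConnected (graphOn f univ) := by
  refine ⟨⟨(0, f 0), by simp⟩, ?_⟩
  have hdense : ∀ W : Set (ℝ × ℝ), IsOpen W → W.Nonempty → ∃ x, (x, f x) ∈ W := by
    rintro W hW ⟨⟨a, b⟩, hab⟩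
    obtain ⟨r, hr, hrW⟩ := Metric.nhds_basis_closedBall.mem_iff.1 (hW.mem_nhds hab)
    have hfst : Metric.ball a r ⊆ Prod.fst '' Metric.closedBall (a, b) r := fun x hx ↦
      ⟨(x, b), by
        rw [Metric.mem_closedBall, Prod.dist_eq, dist_self]
        exact max_le (Metric.mem_ball.1 hx).le hr.le, rfl⟩
    obtain ⟨x, hx⟩ := hf _ Metric.isClosed_closedBall
      ⟨a, interior_maximal hfst Metric.isOpen_ball (Metric.mem_ball_self hr)⟩
    exact ⟨x, hrW hx⟩
  rintro U V hU hV hUV ⟨_, ⟨a, -, rfl⟩, haU⟩ ⟨_, ⟨b, -, rfl⟩, hbV⟩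
  by_contra hcon
  have hdisj : U ∩ V = ∅ := by
    by_contra hne
    obtain ⟨x, hx⟩ := hdense _ (hU.inter hV) (nonempty_iff_ne_empty.2 hne)
    exact hcon ⟨(x, f x), by simp, hx⟩
  have hcover : ∀ x, (x, f x) ∈ U ∪ V := fun x ↦ hUV (by simp)
  have hUo : IsOpen (Prod.fst '' U) := isOpenMap_fst U hU
  have hVo : IsOpen (Prod.fst '' V) := isOpenMap_fst V hV
  obtain ⟨c, -, hc⟩ := isPreconnected_univ (Prod.fst '' U) (Prod.fst '' V) hUo hVo
    (fun x _ ↦ (hcover x).imp (fun h ↦ ⟨_, h, rfl⟩) fun h ↦ ⟨_, h, rfl⟩)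
    ⟨a, mem_univ _, _, haU, rfl⟩ ⟨b, mem_univ _, _, hbV, rfl⟩
  -- A vertical line meeting both `U` and `V` is connected, so these disjoint open sets cannot cover
  -- it. The closed complement of `U ∪ V` thus has a fat projection and meets the graph.
  have hsub : Prod.fst '' U ∩ Prod.fst '' V ⊆ Prod.fst '' (U ∪ V)ᶜ := by
    rintro x ⟨⟨⟨x₁, y⟩, hyU, (h₁ : x₁ = x)⟩, ⟨⟨x₂, z⟩, hzV, (h₂ : x₂ = x)⟩⟩
    rw [h₁] at hyU
    rw [h₂] at hzV
    by_contra hx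
    have hline : (univ : Set ℝ) ⊆ Prod.mk x ⁻¹' U ∪ Prod.mk x ⁻¹' V := fun t _ ↦ by
      by_contra ht
      exact hx ⟨(x, t), ht, rfl⟩
    obtain ⟨t, -, htU, htV⟩ := isPreconnected_univ _ _
      (hU.preimage (Continuous.prodMk_right x)) (hV.preimage (Continuous.prodMk_right x)) hline
      ⟨y, mem_univ _, hyU⟩ ⟨z, mem_univ _, hzV⟩
    exact (hdisj ▸ ⟨htU, htV⟩ : (x, t) ∈ (∅ : Set (ℝ × ℝ)))
  obtain ⟨x, hx⟩ := hf _ (hU.union hV).isClosed_compl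
    ⟨c, interior_maximal hsub (hUo.inter hVo) hc⟩
  exact hx (hcover x)

/-- A function whose graph meets every closed set with a fat projection is discontinuous:
its graph misses that of `f + 1`. -/
theorem not_continuous_of_meets_closed {f : ℝ → ℝ}
    (hf : ∀ F : Set (ℝ × ℝ), IsClosed F → (interior (Prod.fst '' F)).Nonempty →
      ∃ x, (x, f x) ∈ F) : ¬ Continuous f := by
  intro hcont
  have hfst : (univ : Set ℝ) ⊆ Prod.fst '' {p : ℝ × ℝ | p.2 = f p.1 + 1} :=
    fun x _ ↦ ⟨(x, f x + 1), rfl, rfl⟩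
  obtain ⟨x, hx⟩ := hf {p | p.2 = f p.1 + 1} (isClosed_eq (by fun_prop) (by fun_prop))
    ⟨0, interior_maximal hfst isOpen_univ (mem_univ _)⟩
  have : f x = f x + 1 := hx
  linarith

/-- The graph of an additive function is connected or totally disconnected. -/
theorem AddMonoidHom.isConnected_or_isTotallyDisconnected_graphOn (f : ℝ →+ ℝ) :
    IsConnected (graphOn f univ) ∨ IsTotallyDisconnected (graphOn f univ) := by
  have hgraph : graphOn f univ = (f.graph : Set (ℝ × ℝ)) := by
    ext
    simp
  rw [hgraph]
  by_cases h : connectedComponent (0 : f.graph) = {0}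
  · exact Or.inr (totallyDisconnectedSpace_subtype_iff.1
      (totallyDisconnectedSpace_iff_connectedComponent_zero.2 h))
  left
  let K := AddSubgroup.connectedComponentOfZero f.graph
  let π : f.graph →+ ℝ := (AddMonoidHom.fst ℝ ℝ).comp f.graph.subtype
  have hπ : Continuous π := continuous_fst.comp continuous_subtype_val
  have hinj : Function.Injective π := by
    rintro ⟨⟨x, a⟩, hx : f x = a⟩ ⟨⟨y, b⟩, hy : f y = b⟩ (hxy : x = y)
    subst hx hy hxy
    rfl
  obtain ⟨p, hp, hp0⟩ : ∃ p ∈ connectedComponent (0 : f.graph), p ≠ 0 := by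
    by_contra! hcon
    exact h (subset_antisymm hcon (singleton_subset_iff.2 mem_connectedComponent))
  have hpπ : π p ≠ 0 := fun hp' ↦ hp0 (hinj (hp'.trans π.map_zero.symm))
  have hconn : IsPreconnected (π '' connectedComponent (0 : f.graph)) :=
    isPreconnected_connectedComponent.image _ hπ.continuousOn
  have hsub : uIcc 0 (π p) ⊆ (K.map π : Set ℝ) :=
    hconn.ordConnected.uIcc_subset ⟨0, mem_connectedComponent, π.map_zero⟩ ⟨p, hp, rfl⟩
  have htop : K.map π = ⊤ := AddSubgroup.eq_top_of_interior_nonempty _ <| by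
    refine Set.Nonempty.mono (interior_mono hsub) ?_
    rw [uIcc, interior_Icc, nonempty_Ioo]
    exact inf_lt_sup.2 hpπ.symm
  have huniv : connectedComponent (0 : f.graph) = Set.univ := by
    refine eq_univ_of_forall fun q ↦ ?_
    obtain ⟨q', hq', hqq'⟩ : π q ∈ K.map π := htop ▸ AddSubgroup.mem_top _
    rwa [← hinj hqq']
  have : ConnectedSpace f.graph :=
    connectedSpace_iff_univ.2 (huniv ▸ isConnected_connectedComponent)
  exact isConnected_iff_connectedSpace.2 this

/-- A function with countable range that is not constant has no connected graph. -/
theorem not_isConnected_graphOn_of_countable_range {f : ℝ → ℝ} (hf : (range f).Countable)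
    {x y : ℝ} (hxy : f x ≠ f y) : ¬ IsConnected (graphOn f univ) := by
  intro h
  have hrange := h.isPreconnected.image Prod.snd continuous_snd.continuousOn
  rw [image_snd_graphOn, image_univ] at hrange
  exact hxy (hf.isTotallyDisconnected _ subset_rfl hrange (mem_range_self x) (mem_range_self y))

theorem corollary2 :
    (∀ f : ℝ → ℝ, (∀ x y : ℝ, f (x + y) = f x + f y) →
      IsConnected (Set.graphOn f Set.univ) ∨ IsTotallyDisconnected (Set.graphOn f Set.univ)) ∧
    (∃ f : ℝ → ℝ, (∀ x y : ℝ, f (x + y) = f x + f y) ∧ ¬ Continuous f ∧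
      IsConnected (Set.graphOn f Set.univ)) ∧
    (∃ f : ℝ → ℝ, (∀ x y : ℝ, f (x + y) = f x + f y) ∧ ¬ Continuous f ∧
      IsTotallyDisconnected (Set.graphOn f Set.univ)) := by
  have dichotomy (f : ℝ → ℝ) (hf : ∀ x y : ℝ, f (x + y) = f x + f y) :
      IsConnected (graphOn f univ) ∨ IsTotallyDisconnected (graphOn f univ) :=
    (AddMonoidHom.mk' f hf).isConnected_or_isTotallyDisconnected_graphOn
  refine ⟨dichotomy, ?_, ?_⟩
  · obtain ⟨f, hf⟩ := exists_linearMap_graph_meets_closed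
    exact ⟨f, map_add f, not_continuous_of_meets_closed hf, isConnected_graphOn_of_meets_closed hf⟩
  · obtain ⟨φ, hφ⟩ := Module.Projective.exists_dual_ne_zero ℚ (one_ne_zero (α := ℝ))
    let f : ℝ → ℝ := fun x ↦ φ x
    have hadd : ∀ x y, f (x + y) = f x + f y := fun x y ↦ by simp [f]
    have hcount : (range f).Countable :=
      (countable_range ((↑) : ℚ → ℝ)).mono (range_comp_subset_range φ _)
    have hne : f 1 ≠ f 0 := by simpa [f] using hφ
    have hnot := not_isConnected_graphOn_of_countable_range hcount hne
    refine ⟨f, hadd, fun hcont ↦ hnot ?_, (dichotomy f hadd).resolve_left hnot⟩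
    -- Continuity would make the graph a continuous image of ℝ.
    exact isConnected_univ.image _ (continuous_id.prodMk hcont).continuousOn
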